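/- **Theorem 1.** Let $f:\mathbb R^n\times\mathbb R^m\to\mathbb R^n$ and $r:\mathbb R^n\times\mathbb R^m\to\mathbb R$ be bounded and Lipschitz continuous, and let $\gamma>0$, $L\ge 0$. For $t\in\mathbb R$ let $\mathcal A_t$ be the set of Lipschitz continuous controls $a:[t,\infty)\to\mathbb R^m$ with $|\dot a(s)|\le L$ for a.e. $s\ge t$. For $a\in\mathcal A_t$ and $\boldsymbol x\in\mathbb R^n$ let $x(\cdot)$ be the solution of $\dot x(s)=f(x(s),a(s))$, $s\ge t$, $x(t)=\boldsymbol x$, and put $$J_{t,\boldsymbol x}(a)=\int_t^\infty e^{-\gamma(s-t)}\,r(x(s),a(s))\,ds .$$ Define the Q-function by $$Q(\boldsymbol x,\boldsymbol a)=\sup\{J_{0,\boldsymbol x}(a)\;:\;a\in\mathcal A_0,\ a(0)=\boldsymbol a\}.$$ Let $D^+Q$ and $D^-Q$ denote the super- and subdifferential of $Q$, $$D^+Q(z)=\Big\{p:\limsup_{y\to z}\tfrac{Q(y)-Q(z)-p\cdot(y-z)}{|y-z|}\le 0\Big\},\qquad D^-Q(z)=\Big\{p:\liminf_{y\to z}\tfrac{Q(y)-Q(z)-p\cdot(y-z)}{|y-z|}\ge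 0\Big\},$$ let $D^\pm Q=D^+Q\cup D^-Q$, and let $\partial Q$ be Clarke's generalized gradient, $$\partial Q(z)=\Big\{p:\ p\cdot q\le\limsup_{y\to z,\,h\to0^+}\tfrac{Q(y+hq)-Q(y)}{h}\ \text{ for all } q\in\mathbb R^n\times\mathbb R^m\Big\}.$$ Fix $t\in\mathbb R$, $\boldsymbol x\in\mathbb R^n$, $\boldsymbol a\in\mathbb R^m$. Let $a^\star\in\mathcal A_t$ with $a^\star(t)=\boldsymbol a$, let $x^\star$ be its state trajectory with $x^\star(t)=\boldsymbol x$, and suppose that for a.e. $s\ge t$ $$\dot a^\star(s)=L\,\frac{p_2}{|p_2|}\qquad\text{for all } p=(p_1,p_2)\in D^\pm Q(x^\star(s),a^\star(s))\text{ with }p_2\neq0$$ (elements $p$ with $p_2=0$ impose no condition). Assume that for every $s\ge t$ the function $Q$ is Lipschitz continuous on some neighborhood of $(x^\star(s),a^\star(s))$, and that $D^+Q(x^\star(s),a^\star(s))=\partial Q(x^\star(s),a^\star(s))$ for a.e. $s\ge t$. Then $a^\star$ is optimal among the admissible controls starting at $\boldsymbol a$: $$J_{t,\boldsymbol x}(a^\star)\ge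 J_{t,\boldsymbol x}(a)\qquad\text{for all } a\in\mathcal A_t\text{ with }a(t)=\boldsymbol a .$$ If, in addition, $\boldsymbol a\in\operatorname{arg\,max}_{\boldsymbol a'\in\mathbb R^m}Q(\boldsymbol x,\boldsymbol a')$, then $a^\star$ is an optimal control: $$J_{t,\boldsymbol x}(a^\star)\ge J_{t,\boldsymbol x}(a)\qquad\text{for all } a\in\mathcal A_t .$$ -/

import Mathlib

open Set Filter Topology MeasureTheory
open scoped NNReal

noncomputable section

namespace LipControl

/-- Euclidean space `ℝᵏ`. -/
abbrev E (k : ℕ) : Type := EuclideanSpace ℝ (Fin k)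

/-- The Euclidean dot product `p · z = p₁ · z₁ + p₂ · z₂` on `ℝⁿ × ℝᵐ`. -/
def dot {n m : ℕ} (p z : E n × E m) : ℝ := inner ℝ p.1 z.1 + inner ℝ p.2 z.2

/-- Admissible controls on `[t, ∞)`: Lipschitz continuous functions with `|ȧ| ≤ L` a.e.
A Lipschitz function is differentiable a.e., so `deriv` is the true derivative a.e. -/
def IsAdmissible {m : ℕ} (L t : ℝ) (a : ℝ → E m) : Prop :=
  (∃ K : ℝ≥0, LipschitzOnWith K a (Ici t)) ∧
    ∀ᵐ s ∂(volume.restrict (Ici t)), ‖deriv a s‖ ≤ L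

/-- `x` solves `ẋ = f(x, a)` on `[t, ∞)` (one-sided derivative at `t`) with `x(t) = x₀`. -/
def IsTrajectory {n m : ℕ} (f : E n × E m → E n) (t : ℝ) (x₀ : E n)
    (a : ℝ → E m) (x : ℝ → E n) : Prop :=
  x t = x₀ ∧ ∀ s ∈ Ici t, HasDerivWithinAt x (f (x s, a s)) (Ici t) s

/-- All pairs (state, control) on `[t, ∞)` with an admissible control and `x(t) = x₀`.
For Lipschitz `f` the state is determined on `[t, ∞)` by the control. -/
def AdmissiblePairs {n m : ℕ} (f : E n × E m → E n) (L t : ℝ) (x₀ : E n) :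
    Set ((ℝ → E n) × (ℝ → E m)) :=
  {w | IsAdmissible L t w.2 ∧ IsTrajectory f t x₀ w.2 w.1}

/-- The admissible pairs whose control also starts at `a(t) = a₀`. -/
def AdmissiblePairsFrom {n m : ℕ} (f : E n × E m → E n) (L t : ℝ) (x₀ : E n) (a₀ : E m) :
    Set ((ℝ → E n) × (ℝ → E m)) :=
  {w ∈ AdmissiblePairs f L t x₀ | w.2 t = a₀}

/-- The discounted reward `∫_t^∞ e^{-γ (s - t)} r(x(s), a(s)) ds`. -/
def reward {n m : ℕ} (r : E n × E m → ℝ) (γ t : ℝ) (w : (ℝ → E n) × (ℝ → E m)) : ℝ :=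
  ∫ s in Ioi t, Real.exp (-γ * (s - t)) * r (w.1 s, w.2 s)

/-- The Q-function: the supremum of the reward from time `0` over admissible controls, with
`x(0) = z.1` and `a(0) = z.2`. For bounded Lipschitz `f`, `r`, and for `γ > 0`, `L ≥ 0`, the set
of rewards is nonempty and bounded. -/
def qFun {n m : ℕ} (f : E n × E m → E n) (r : E n × E m → ℝ) (γ L : ℝ) (z : E n × E m) : ℝ :=
  sSup (reward r γ 0 '' AdmissiblePairsFrom f L 0 z.1 z.2)

/-- The superdifferential `D⁺u(z)`:
`limsup_{y → z} (u(y) - u(z) - p · (y - z)) / |y - z| ≤ 0`. -/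
def superDiff {n m : ℕ} (u : E n × E m → ℝ) (z : E n × E m) : Set (E n × E m) :=
  {p | ∀ ε : ℝ, 0 < ε → ∀ᶠ y in 𝓝 z, u y - u z - dot p (y - z) ≤ ε * ‖y - z‖}

/-- The subdifferential `D⁻u(z)`:
`liminf_{y → z} (u(y) - u(z) - p · (y - z)) / |y - z| ≥ 0`. -/
def subDiff {n m : ℕ} (u : E n × E m → ℝ) (z : E n × E m) : Set (E n × E m) :=
  {p | ∀ ε : ℝ, 0 < ε → ∀ᶠ y in 𝓝 z, -(ε * ‖y - z‖) ≤ u y - u z - dot p (y - z)}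

/-- Clarke's generalized directional derivative
`u°(z; q) = limsup_{y → z, h → 0+} (u(y + h q) - u(y)) / h`. -/
def clarkeDeriv {n m : ℕ} (u : E n × E m → ℝ) (z q : E n × E m) : EReal :=
  limsup (fun w : (E n × E m) × ℝ => (((u (w.1 + w.2 • q) - u w.1) / w.2 : ℝ) : EReal))
    (𝓝 z ×ˢ 𝓝[>] (0 : ℝ))

/-- Clarke's generalized gradient `∂u(z) = {p | p · q ≤ u°(z; q) for all q}`. -/
def clarkeGradient {n m : ℕ} (u : E n × E m → ℝ) (z : E n × E m) : Set (E n × E m) :=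
  {p | ∀ q : E n × E m, ((dot p q : ℝ) : EReal) ≤ clarkeDeriv u z q}

end LipControl

end

namespace LipControl

/-! Every admissible pair earns at most the Q-function at its starting point (`reward_le_qFun`), so
it suffices that the given pair earns at least that much (`qFun_le_reward`).

For `p ∈ D⁺Q`, dynamic programming gives `γQ ≤ r + p₁·f + L|p₂|`
(`qFun_le_hamiltonian_of_mem_superDiff`). If `p₂ ≠ 0`, the given control moves in direction `p₂` at
speed `L`, so `L|p₂| = p₂·ȧ`; if `p₂ = 0`, both terms vanish. The right side is thus `r + p·(ẋ, ȧ)`,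
which is `r + dQ/ds` for a.e. time by `hasDerivAt_comp_eq_of_mem_superDiff`. Integrating `dQ/ds ≥ γQ
- r` with the discount factor up to infinity bounds Q by the reward (`le_reward_of_deriv_ge`).

The argument needs one supergradient at almost every time. There `D⁺Q = ∂Q`, and Hahn–Banach makes
`∂Q` nonempty for locally Lipschitz Q (`clarkeGradient_nonempty`). -/

/-- Every linear functional on `ℝⁿ × ℝᵐ` is a dot product. -/
lemma exists_dot_eq {n m : ℕ} (g : E n × E m →ₗ[ℝ] ℝ) : ∃ p : E n × E m, ∀ q, dot p q = g q := by
  let g₁ : E n →L[ℝ] ℝ := LinearMap.toContinuousLinearMap (g ∘ₗ LinearMap.inl ℝ (E n) (E m))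
  let g₂ : E m →L[ℝ] ℝ := LinearMap.toContinuousLinearMap (g ∘ₗ LinearMap.inr ℝ (E n) (E m))
  refine ⟨((InnerProductSpace.toDual ℝ (E n)).symm g₁,
    (InnerProductSpace.toDual ℝ (E m)).symm g₂), fun q => ?_⟩
  simp only [dot, InnerProductSpace.toDual_symm_apply]
  simp only [g₁, g₂, LinearMap.coe_toContinuousLinearMap', LinearMap.comp_apply,
    LinearMap.inl_apply, LinearMap.inr_apply, ← map_add]
  simp

/-! ### Difference quotients and nonemptiness of Clarke's gradient -/

/-- Points `y → z` and step sizes `h → 0+`. -/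
def stepFilter {V : Type*} [TopologicalSpace V] (z : V) : Filter (V × ℝ) :=
  𝓝 z ×ˢ 𝓝[>] (0 : ℝ)

instance {V : Type*} [TopologicalSpace V] (z : V) : (stepFilter z).NeBot := by
  unfold stepFilter
  infer_instance

lemma tendsto_stepFilter_mul {V : Type*} [TopologicalSpace V] {z : V} {c : ℝ} (hc : 0 < c) :
    Tendsto (fun w : V × ℝ => (w.1, c * w.2)) (stepFilter z) (stepFilter z) := by
  refine Tendsto.prodMk tendsto_fst ?_
  refine Tendsto.comp (g := fun h : ℝ => c * h) (y := 𝓝[>] 0) ?_ tendsto_snd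
  refine tendsto_nhdsWithin_iff.2 ⟨?_, ?_⟩
  · have : Tendsto (fun h : ℝ => c * h) (𝓝 0) (𝓝 (c * 0)) := (continuous_const_mul c).tendsto 0
    rw [mul_zero] at this
    exact this.mono_left nhdsWithin_le_nhds
  · filter_upwards [self_mem_nhdsWithin] with h hh using mul_pos hc hh

lemma eventually_stepFilter_pos {V : Type*} [TopologicalSpace V] {z : V} :
    ∀ᶠ w : V × ℝ in stepFilter z, 0 < w.2 :=
  tendsto_snd.eventually (self_mem_nhdsWithin : Ioi (0 : ℝ) ∈ 𝓝[>] 0)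

/-- The eventual upper bounds of the difference quotients of `u` near `z` in direction `q`. -/
def quotientBounds {V : Type*} [NormedAddCommGroup V] [NormedSpace ℝ V] (u : V → ℝ) (z q : V) :
    Set ℝ :=
  {c | ∀ᶠ w : V × ℝ in stepFilter z, (u (w.1 + w.2 • q) - u w.1) / w.2 ≤ c}

section Clarke

variable {V : Type*} [NormedAddCommGroup V] [NormedSpace ℝ V] {u : V → ℝ} {z : V}

lemma tendsto_stepFilter_add (q : V) :
    Tendsto (fun w : V × ℝ => (w.1 + w.2 • q, w.2)) (stepFilter z) (stepFilter z) := by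
  refine Tendsto.prodMk ?_ tendsto_snd
  have h2 : Tendsto (fun w : V × ℝ => w.2) (stepFilter z) (𝓝 0) :=
    tendsto_snd.mono_right nhdsWithin_le_nhds
  have h1 : Tendsto (fun w : V × ℝ => w.1) (stepFilter z) (𝓝 z) := tendsto_fst
  simpa using h1.add (h2.smul_const q)

lemma eventually_abs_quotient_le {K : ℝ≥0} {U : Set V} (hU : U ∈ 𝓝 z)
    (hu : LipschitzOnWith K u U) (q : V) :
    ∀ᶠ w : V × ℝ in stepFilter z, |(u (w.1 + w.2 • q) - u w.1) / w.2| ≤ K * ‖q‖ := by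
  have h1 : ∀ᶠ w : V × ℝ in stepFilter z, w.1 ∈ U := tendsto_fst.eventually hU
  have h2 := (tendsto_stepFilter_add (z := z) q).eventually h1
  filter_upwards [h1, h2, eventually_stepFilter_pos] with w hw1 hw2 hw3
  have := hu.dist_le_mul _ hw2 _ hw1
  rw [Real.dist_eq, dist_eq_norm, add_sub_cancel_left, norm_smul, Real.norm_of_nonneg hw3.le] at this
  rw [abs_div, abs_of_pos hw3, div_le_iff₀ hw3]
  linarith

lemma quotientBounds_bddBelow {K : ℝ≥0} {U : Set V} (hU : U ∈ 𝓝 z)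
    (hu : LipschitzOnWith K u U) (q : V) : BddBelow (quotientBounds u z q) := by
  refine ⟨-(K * ‖q‖), fun c hc => ?_⟩
  obtain ⟨w, h1, h2⟩ := ((eventually_abs_quotient_le hU hu q).and hc).exists
  exact (neg_le_of_abs_le h1).trans h2

lemma quotientBounds_nonempty {K : ℝ≥0} {U : Set V} (hU : U ∈ 𝓝 z)
    (hu : LipschitzOnWith K u U) (q : V) : (quotientBounds u z q).Nonempty :=
  ⟨K * ‖q‖, (eventually_abs_quotient_le hU hu q).mono fun _ h => (le_abs_self _).trans h⟩

/-- The step along `q₁ + q₂` splits at `y + h q₁`. The second piece has a moved base point, which is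
harmless because the limsup runs over base points too. -/
lemma quotientBounds_add {q₁ q₂ : V} {c₁ c₂ : ℝ} (h₁ : c₁ ∈ quotientBounds u z q₁)
    (h₂ : c₂ ∈ quotientBounds u z q₂) : c₁ + c₂ ∈ quotientBounds u z (q₁ + q₂) := by
  filter_upwards [h₁, (tendsto_stepFilter_add q₁).eventually h₂] with w hw1 hw2
  refine le_trans (le_of_eq ?_) (add_le_add hw1 hw2)
  rw [← add_div, smul_add, add_assoc]
  ring

lemma quotientBounds_smul {q : V} {c b : ℝ} (hc : 0 < c) (h : b ∈ quotientBounds u z q) :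
    c * b ∈ quotientBounds u z (c • q) := by
  filter_upwards [(tendsto_stepFilter_mul hc).eventually h, eventually_stepFilter_pos] with w hw hw3
  refine le_trans (le_of_eq ?_) (mul_le_mul_of_nonneg_left hw hc.le)
  rw [smul_smul, mul_comm w.2 c]
  field_simp

lemma sInf_quotientBounds_smul_le {K : ℝ≥0} {U : Set V} (hU : U ∈ 𝓝 z)
    (hu : LipschitzOnWith K u U) {c : ℝ} (hc : 0 < c) (q : V) :
    sInf (quotientBounds u z (c • q)) ≤ c * sInf (quotientBounds u z q) := by
  rw [← div_le_iff₀' hc]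
  refine le_csInf (quotientBounds_nonempty hU hu q) fun b hb => ?_
  rw [div_le_iff₀' hc]
  exact csInf_le (quotientBounds_bddBelow hU hu _) (quotientBounds_smul hc hb)

end Clarke

/-- Clarke's generalized gradient of a locally Lipschitz function is nonempty. -/
theorem clarkeGradient_nonempty {n m : ℕ} {u : E n × E m → ℝ} {z : E n × E m} {K : ℝ≥0}
    {U : Set (E n × E m)} (hU : U ∈ 𝓝 z) (hu : LipschitzOnWith K u U) :
    (clarkeGradient u z).Nonempty := by
  -- Clarke's derivative as a real number: the Lipschitz bound makes the infimum finite.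
  let N : E n × E m → ℝ := fun q => sInf (quotientBounds u z q)
  have N_hom : ∀ c : ℝ, 0 < c → ∀ q, N (c • q) = c * N q := fun c hc q => by
    refine le_antisymm (sInf_quotientBounds_smul_le hU hu hc q) ?_
    have h := sInf_quotientBounds_smul_le hU hu (inv_pos.2 hc) (c • q)
    rw [smul_smul, inv_mul_cancel₀ hc.ne', one_smul] at h
    rwa [le_inv_mul_iff₀ hc] at h
  have N_add : ∀ q₁ q₂, N (q₁ + q₂) ≤ N q₁ + N q₂ := fun q₁ q₂ => by
    rw [← sub_le_iff_le_add]
    refine le_csInf (quotientBounds_nonempty hU hu q₁) fun c₁ h₁ => ?_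
    rw [sub_le_comm]
    refine le_csInf (quotientBounds_nonempty hU hu q₂) fun c₂ h₂ => ?_
    rw [sub_le_iff_le_add']
    exact csInf_le (quotientBounds_bddBelow hU hu _) (quotientBounds_add h₁ h₂)
  -- Hahn–Banach, extending the zero functional from the trivial subspace.
  obtain ⟨g, -, hg⟩ := exists_extension_of_le_sublinear (⊥ : E n × E m →ₗ.[ℝ] ℝ) N N_hom N_add (by
    rintro ⟨q, hq⟩
    obtain rfl : q = 0 := (Submodule.mem_bot ℝ).1 hq
    have h0 : N 0 = 0 := by
      have := N_hom 2 two_pos 0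
      rw [smul_zero] at this
      linarith
    exact (LinearPMap.map_zero _).trans_le h0.ge)
  obtain ⟨p, hp⟩ := exists_dot_eq g
  refine ⟨p, fun q => ?_⟩
  rw [hp, clarkeDeriv, limsup_eq]
  refine le_sInf fun b hb => ?_
  induction b with
  | top => exact le_top
  | bot =>
    obtain ⟨w, hw⟩ := (show ∀ᶠ w in stepFilter z, _ from hb).exists
    exact absurd hw (by simp)
  | coe b =>
    have : b ∈ quotientBounds u z q :=
      Eventually.mono (show ∀ᶠ w in stepFilter z, _ from hb) fun w hw => EReal.coe_le_coe_iff.1 hw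
    exact EReal.coe_le_coe_iff.2 ((hg q).trans (csInf_le (quotientBounds_bddBelow hU hu q) this))

lemma ae_restrict_Ici_lt (t : ℝ) : ∀ᵐ s ∂(volume.restrict (Ici t)), t < s := by
  rw [← restrict_Ioi_eq_restrict_Ici]
  exact ae_restrict_mem measurableSet_Ioi

/-! ### Admissible controls -/

section Control

variable {m : ℕ} {L t : ℝ} {a : ℝ → E m}

lemma IsAdmissible.ae_differentiableAt (ha : IsAdmissible L t a) :
    ∀ᵐ s ∂(volume.restrict (Ici t)), DifferentiableAt ℝ a s := by
  obtain ⟨⟨K, hK⟩, -⟩ := ha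
  filter_upwards [hK.ae_differentiableWithinAt_real measurableSet_Ici, ae_restrict_Ici_lt t]
    with s hs hts using hs.differentiableAt (Ici_mem_nhds hts)

/-- Pairing with `v = a s - a t` reduces to a scalar absolutely continuous function: `‖v‖² = ∫ ⟨v,
ȧ⟩ ≤ ‖v‖ L (s - t)`. -/
lemma IsAdmissible.norm_sub_le (ha : IsAdmissible L t a) {s : ℝ} (hts : t ≤ s) :
    ‖a s - a t‖ ≤ L * (s - t) := by
  have hd := ha.ae_differentiableAt
  obtain ⟨⟨K, hK⟩, hL⟩ := ha
  set v := a s - a t with hv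
  let g : ℝ → ℝ := fun τ => inner ℝ v (a τ)
  have hg : LipschitzOnWith (‖innerSL ℝ v‖₊ * K) g (uIcc t s) := by
    rw [uIcc_of_le hts]
    exact (innerSL ℝ v).lipschitz.comp_lipschitzOnWith (hK.mono Icc_subset_Ici_self)
  have hac := hg.absolutelyContinuousOnInterval
  have hle : ∫ τ in t..s, deriv g τ ≤ ∫ _ in t..s, ‖v‖ * L := by
    refine intervalIntegral.integral_mono_ae_restrict hts hac.intervalIntegrable_deriv
      intervalIntegrable_const (ae_restrict_of_ae_restrict_of_subset Icc_subset_Ici_self ?_)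
    filter_upwards [hd, hL] with τ h1 h2
    have : HasDerivAt g (inner ℝ v (deriv a τ)) τ :=
      (innerSL ℝ v).hasFDerivAt.comp_hasDerivAt τ h1.hasDerivAt
    rw [this.deriv]
    exact (real_inner_le_norm _ _).trans (mul_le_mul_of_nonneg_left h2 (norm_nonneg _))
  rw [hac.integral_deriv_eq_sub, intervalIntegral.integral_const, smul_eq_mul] at hle
  have h3 : g s - g t = ‖v‖ * ‖v‖ := by
    simp only [g]
    rw [← inner_sub_right, ← hv, real_inner_self_eq_norm_mul_norm]
  -- Division by `‖v‖` fails when `v = 0`; then `0 ≤ L` is read off at a time where the derivative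
  -- bound holds.
  rcases (norm_nonneg v).eq_or_lt with h0 | h0
  · rw [← h0, zero_mul] at hle
    rw [← h0]
    rcases hts.eq_or_lt with rfl | hlt
    · simp
    · obtain ⟨τ, hτ⟩ : ∃ τ, ‖deriv a τ‖ ≤ L := by
        have : (volume.restrict (Ici t)) ≠ 0 := by simp
        have : (ae (volume.restrict (Ici t))).NeBot := ae_neBot.2 this
        exact hL.exists
      exact mul_nonneg ((norm_nonneg _).trans hτ) (sub_nonneg.2 hts)
  · rw [h3] at hle
    refine le_of_mul_le_mul_left (hle.trans_eq ?_) h0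
    ring

lemma IsAdmissible.comp_add {t' s : ℝ} (ha : IsAdmissible L t a) (hts : t ≤ t' + s) :
    IsAdmissible L t' (fun τ => a (τ + s)) := by
  obtain ⟨⟨K, hK⟩, hL⟩ := ha
  have hmaps : MapsTo (fun τ : ℝ => τ + s) (Ici t') (Ici t) := fun τ hτ => by
    simp only [mem_Ici] at hτ ⊢
    linarith
  refine ⟨⟨K, fun τ hτ σ hσ => ?_⟩, ?_⟩
  · simpa using hK (hmaps hτ) (hmaps hσ)
  · rw [ae_restrict_iff' measurableSet_Ici] at hL ⊢
    filter_upwards [(measurePreserving_add_right volume s).quasiMeasurePreserving.ae hL] with τ h hτ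
    rw [deriv_comp_add_const]
    exact h (hmaps hτ)

end Control

/-! ### State-control pairs, rewards and short-time estimates -/

section Pairs

variable {n m : ℕ} {f : E n × E m → E n} {r : E n × E m → ℝ} {γ L t : ℝ} {x₀ : E n}
  {w : (ℝ → E n) × (ℝ → E m)}

/-- The pair `w` with time advanced by `s`. -/
def shift (s : ℝ) (w : (ℝ → E n) × (ℝ → E m)) : (ℝ → E n) × (ℝ → E m) :=
  (fun τ => w.1 (τ + s), fun τ => w.2 (τ + s))

/-- The dynamics are autonomous, so restarting the clock at time `s` preserves admissibility. -/
lemma shift_mem {s : ℝ} (hts : t ≤ s) (hw : w ∈ AdmissiblePairs f L t x₀) :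
    shift s w ∈ AdmissiblePairsFrom f L 0 (w.1 s) (w.2 s) := by
  obtain ⟨ha, -, hx⟩ := hw
  refine ⟨⟨ha.comp_add (by simpa using hts), by simp [shift], fun τ hτ => ?_⟩, by simp [shift]⟩
  have hmaps : MapsTo (fun τ : ℝ => τ + s) (Ici 0) (Ici t) := fun σ hσ => by
    simp only [mem_Ici] at hσ ⊢
    linarith
  have h1 : HasDerivWithinAt (fun τ : ℝ => τ + s) 1 (Ici 0) τ :=
    (hasDerivWithinAt_id τ _).add_const s
  simpa [shift, Function.comp_def] using (hx (τ + s) (hmaps hτ)).scomp τ h1 hmaps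

lemma reward_shift (s : ℝ) (w : (ℝ → E n) × (ℝ → E m)) :
    reward r γ 0 (shift s w) = reward r γ s w := by
  have h := (measurePreserving_add_right volume s).setIntegral_preimage_emb
    (measurableEmbedding_addRight s)
    (fun τ => Real.exp (-γ * (τ - s)) * r (w.1 τ, w.2 τ)) (Ioi s)
  simpa [reward, shift] using h

lemma continuousOn_pair (hw : w ∈ AdmissiblePairs f L t x₀) :
    ContinuousOn (fun s => (w.1 s, w.2 s)) (Ici t) := by
  obtain ⟨⟨⟨K, hK⟩, -⟩, -, hx⟩ := hw
  exact ContinuousOn.prodMk (fun s hs => (hx s hs).continuousWithinAt) hK.continuousOn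

lemma continuousOn_rewardIntegrand (hr : Continuous r) (hw : w ∈ AdmissiblePairs f L t x₀) (s : ℝ) :
    ContinuousOn (fun τ => Real.exp (-γ * (τ - s)) * r (w.1 τ, w.2 τ)) (Ici t) :=
  (Continuous.continuousOn (by fun_prop)).mul (hr.comp_continuousOn (continuousOn_pair hw))

lemma integrableOn_discount (hγ : 0 < γ) (C s t : ℝ) :
    IntegrableOn (fun τ => Real.exp (-γ * (τ - s)) * C) (Ioi t) := by
  have h := (integrableOn_exp_mul_Ioi (neg_neg_of_pos hγ) t).const_mul (Real.exp (γ * s) * C)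
  refine h.congr (Eventually.of_forall fun τ => ?_)
  simp only
  rw [show -γ * (τ - s) = γ * s + -γ * τ by ring, Real.exp_add]
  ring

lemma integrableOn_rewardIntegrand (hγ : 0 < γ) (hr : Continuous r) {C : ℝ} (hC : ∀ z, |r z| ≤ C)
    (hw : w ∈ AdmissiblePairs f L t x₀) (s : ℝ) :
    IntegrableOn (fun τ => Real.exp (-γ * (τ - s)) * r (w.1 τ, w.2 τ)) (Ioi t) := by
  refine (integrableOn_discount hγ C s t).mono'
    (((continuousOn_rewardIntegrand hr hw s).mono Ioi_subset_Ici_self).aestronglyMeasurable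
      measurableSet_Ioi) (Eventually.of_forall fun τ => ?_)
  rw [norm_mul, Real.norm_of_nonneg (Real.exp_pos _).le]
  exact mul_le_mul_of_nonneg_left (hC _) (Real.exp_pos _).le

lemma reward_split (hγ : 0 < γ) (hr : Continuous r) {C : ℝ} (hC : ∀ z, |r z| ≤ C)
    (hw : w ∈ AdmissiblePairs f L t x₀) {s : ℝ} (hts : t ≤ s) :
    reward r γ t w = (∫ τ in t..s, Real.exp (-γ * (τ - t)) * r (w.1 τ, w.2 τ)) +
      Real.exp (-γ * (s - t)) * reward r γ s w := by
  have hi := integrableOn_rewardIntegrand hγ hr hC hw t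
  rw [reward, ← intervalIntegral.integral_interval_add_Ioi hi (hi.mono_set (Ioi_subset_Ioi hts)),
    reward, ← integral_const_mul]
  congr 2
  ext τ
  rw [← mul_assoc, ← Real.exp_add]
  ring_nf

/-- A bound of the reward, uniform over all pairs. -/
noncomputable def rewardBound (γ C : ℝ) : ℝ := ∫ τ in Ioi (0 : ℝ), Real.exp (-γ * (τ - 0)) * C

lemma abs_reward_le (hγ : 0 < γ) {C : ℝ} (hC : ∀ z, |r z| ≤ C) (w : (ℝ → E n) × (ℝ → E m)) :
    |reward r γ 0 w| ≤ rewardBound γ C := by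
  rw [← Real.norm_eq_abs, reward, rewardBound]
  refine norm_integral_le_of_norm_le (integrableOn_discount hγ C 0 0)
    (Eventually.of_forall fun τ => ?_)
  rw [norm_mul, Real.norm_of_nonneg (Real.exp_pos _).le]
  exact mul_le_mul_of_nonneg_left (hC _) (Real.exp_pos _).le

lemma bddAbove_rewards (hγ : 0 < γ) {C : ℝ} (hC : ∀ z, |r z| ≤ C)
    (S : Set ((ℝ → E n) × (ℝ → E m))) : BddAbove (reward r γ 0 '' S) := by
  refine ⟨rewardBound γ C, ?_⟩
  rintro _ ⟨w, -, rfl⟩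
  exact (le_abs_self _).trans (abs_reward_le hγ hC w)

lemma abs_qFun_le (hγ : 0 < γ) {C : ℝ} (hC : ∀ z, |r z| ≤ C) (z : E n × E m)
    (hne : (AdmissiblePairsFrom f L 0 z.1 z.2).Nonempty) :
    |qFun f r γ L z| ≤ rewardBound γ C := by
  obtain ⟨w, hw⟩ := hne
  refine abs_le.2 ⟨?_, ?_⟩
  · exact (abs_le.1 (abs_reward_le hγ hC w)).1.trans
      (le_csSup (bddAbove_rewards hγ hC _) (mem_image_of_mem _ hw))
  · refine csSup_le ⟨_, mem_image_of_mem _ hw⟩ ?_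
    rintro _ ⟨w, -, rfl⟩
    exact (le_abs_self _).trans (abs_reward_le hγ hC w)

/-- The reward of an admissible pair from any time on is at most the Q-function. -/
lemma reward_le_qFun (hγ : 0 < γ) {C : ℝ} (hC : ∀ z, |r z| ≤ C)
    (hw : w ∈ AdmissiblePairs f L t x₀) {s : ℝ} (hts : t ≤ s) :
    reward r γ s w ≤ qFun f r γ L (w.1 s, w.2 s) := by
  rw [← reward_shift]
  exact le_csSup (bddAbove_rewards hγ hC _) (mem_image_of_mem _ (shift_mem hts hw))

lemma norm_state_sub_le {C : ℝ} (hC : ∀ z, ‖f z‖ ≤ C) (hw : w ∈ AdmissiblePairs f L t x₀)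
    {s : ℝ} (hts : t ≤ s) : ‖w.1 s - w.1 t‖ ≤ C * (s - t) := by
  have := (convex_Ici t).norm_image_sub_le_of_norm_hasDerivWithin_le hw.2.2 (fun _ _ => hC _)
    (mem_Ici.2 le_rfl) (mem_Ici.2 hts)
  rwa [Real.norm_of_nonneg (sub_nonneg.2 hts)] at this

lemma norm_pair_sub_le {C : ℝ} (hC : ∀ z, ‖f z‖ ≤ C) (hL : 0 ≤ L)
    (hw : w ∈ AdmissiblePairs f L t x₀) {s : ℝ} (hts : t ≤ s) :
    ‖(w.1 s, w.2 s) - (w.1 t, w.2 t)‖ ≤ (C + L) * (s - t) := by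
  have hC0 : 0 ≤ C := (norm_nonneg _).trans (hC 0)
  have h0 := sub_nonneg.2 hts
  have h1 := norm_state_sub_le hC hw hts
  have h2 := hw.1.norm_sub_le hts
  rw [Prod.mk_sub_mk, Prod.norm_mk, max_le_iff]
  constructor <;> nlinarith

/-- First-order expansion of the state. -/
lemma norm_state_sub_smul_le {C : ℝ} {K : ℝ≥0} (hC : ∀ z, ‖f z‖ ≤ C) (hK : LipschitzWith K f)
    (hL : 0 ≤ L) (hw : w ∈ AdmissiblePairs f L 0 x₀) {h : ℝ} (hh : 0 ≤ h) :
    ‖w.1 h - w.1 0 - h • f (w.1 0, w.2 0)‖ ≤ K * ((C + L) * h) * h := by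
  have hC0 : 0 ≤ C := (norm_nonneg _).trans (hC 0)
  have hd : ∀ s ∈ Icc 0 h, HasDerivWithinAt (fun s => w.1 s - s • f (w.1 0, w.2 0))
      (f (w.1 s, w.2 s) - (1 : ℝ) • f (w.1 0, w.2 0)) (Icc 0 h) s := fun s hs =>
    ((hw.2.2 s hs.1).mono Icc_subset_Ici_self).sub ((hasDerivWithinAt_id s _).smul_const _)
  have hb : ∀ s ∈ Icc 0 h, ‖f (w.1 s, w.2 s) - (1 : ℝ) • f (w.1 0, w.2 0)‖ ≤ K * ((C + L) * h) := by
    intro s hs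
    rw [one_smul, ← dist_eq_norm]
    refine (hK.dist_le_mul _ _).trans (mul_le_mul_of_nonneg_left ?_ K.2)
    rw [dist_eq_norm]
    refine (norm_pair_sub_le hC hL hw hs.1).trans ?_
    rw [sub_zero]
    exact mul_le_mul_of_nonneg_left hs.2 (by positivity)
  have := (convex_Icc 0 h).norm_image_sub_le_of_norm_hasDerivWithin_le hd hb
    (left_mem_Icc.2 hh) (right_mem_Icc.2 hh)
  simp only [zero_smul, sub_zero, Real.norm_of_nonneg hh] at this
  rwa [sub_right_comm] at this

/-- Cauchy–Schwarz on the control increment produces the Hamiltonian term `L‖p.2‖`; the quadratic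
remainder comes from the state expansion. -/
lemma dot_pair_sub_le {C : ℝ} {K : ℝ≥0} (hC : ∀ z, ‖f z‖ ≤ C) (hK : LipschitzWith K f)
    (hL : 0 ≤ L) (hw : w ∈ AdmissiblePairs f L 0 x₀) {h : ℝ} (hh : 0 ≤ h) (p : E n × E m) :
    dot p ((w.1 h, w.2 h) - (w.1 0, w.2 0)) ≤
      h * (inner ℝ p.1 (f (w.1 0, w.2 0)) + L * ‖p.2‖ + ‖p.1‖ * K * (C + L) * h) := by
  have h1 := real_inner_le_norm p.1 (w.1 h - w.1 0 - h • f (w.1 0, w.2 0))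
  have h2 := mul_le_mul_of_nonneg_left (norm_state_sub_smul_le hC hK hL hw hh) (norm_nonneg p.1)
  have h3 := real_inner_le_norm p.2 (w.2 h - w.2 0)
  have h4 := mul_le_mul_of_nonneg_left (hw.1.norm_sub_le hh) (norm_nonneg p.2)
  rw [inner_sub_right, real_inner_smul_right] at h1
  simp only [dot, Prod.mk_sub_mk]
  linarith

lemma integral_rewardIntegrand_le (hγ : 0 < γ) {C Cr : ℝ} {K : ℝ≥0} (hC : ∀ z, ‖f z‖ ≤ C)
    (hCr : ∀ z, |r z| ≤ Cr) (hK : LipschitzWith K r) (hL : 0 ≤ L)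
    (hw : w ∈ AdmissiblePairs f L 0 x₀) {h : ℝ} (hh : 0 ≤ h) :
    ∫ τ in (0 : ℝ)..h, Real.exp (-γ * (τ - 0)) * r (w.1 τ, w.2 τ) ≤
      h * (r (w.1 0, w.2 0) + (K * (C + L) + γ * Cr) * h) := by
  have hC0 : 0 ≤ C := (norm_nonneg _).trans (hC 0)
  have hCr0 : 0 ≤ Cr := (abs_nonneg _).trans (hCr 0)
  have hle : ∫ τ in (0 : ℝ)..h, Real.exp (-γ * (τ - 0)) * r (w.1 τ, w.2 τ) ≤
      ∫ _ in (0 : ℝ)..h, (r (w.1 0, w.2 0) + (K * (C + L) + γ * Cr) * h) := by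
    refine intervalIntegral.integral_mono_on hh ?_ intervalIntegrable_const fun τ hτ => ?_
    · refine ContinuousOn.intervalIntegrable ?_
      rw [uIcc_of_le hh]
      exact (continuousOn_rewardIntegrand hK.continuous hw 0).mono Icc_subset_Ici_self
    · have h1 : r (w.1 τ, w.2 τ) - r (w.1 0, w.2 0) ≤ K * ((C + L) * τ) := by
        refine (le_abs_self _).trans ((hK.dist_le_mul _ _).trans
          (mul_le_mul_of_nonneg_left ?_ K.2))
        simpa [dist_eq_norm] using norm_pair_sub_le hC hL hw hτ.1
      have h2 : 1 - γ * τ ≤ Real.exp (-γ * (τ - 0)) := by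
        have := Real.add_one_le_exp (-γ * (τ - 0))
        linarith
      have h3 : Real.exp (-γ * (τ - 0)) ≤ 1 := by
        rw [Real.exp_le_one_iff, sub_zero]
        nlinarith [hτ.1]
      have h4 := abs_le.1 (hCr (w.1 τ, w.2 τ))
      have h5 : (K * (C + L) + γ * Cr) * τ ≤ (K * (C + L) + γ * Cr) * h :=
        mul_le_mul_of_nonneg_left hτ.2 (by positivity)
      -- The cost of replacing the discount factor by 1, which matters when `r` is negative.
      have h6 : (1 - Real.exp (-γ * (τ - 0))) * (-r (w.1 τ, w.2 τ)) ≤ γ * τ * Cr :=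
        (mul_le_mul_of_nonneg_left (by linarith) (by linarith)).trans
          (mul_le_mul_of_nonneg_right (by linarith) hCr0)
      linarith
  rwa [intervalIntegral.integral_const, sub_zero, smul_eq_mul] at hle

end Pairs

/-! ### The Hamilton–Jacobi–Bellman inequality -/

variable {n m : ℕ} {f : E n × E m → E n} {r : E n × E m → ℝ} {γ L t : ℝ} {x₀ : E n}
  {w : (ℝ → E n) × (ℝ → E m)}

/-- The Q-function is a viscosity subsolution of the Hamilton–Jacobi–Bellman equation. -/
theorem qFun_le_hamiltonian_of_mem_superDiff (hγ : 0 < γ) (hL : 0 ≤ L) {C Cr : ℝ} {K Kr : ℝ≥0}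
    (hC : ∀ z, ‖f z‖ ≤ C) (hCr : ∀ z, |r z| ≤ Cr) (hK : LipschitzWith K f)
    (hKr : LipschitzWith Kr r) {z p : E n × E m}
    (hne : (AdmissiblePairsFrom f L 0 z.1 z.2).Nonempty)
    (hp : p ∈ superDiff (qFun f r γ L) z) :
    γ * qFun f r γ L z ≤ r z + (inner ℝ p.1 (f z) + L * ‖p.2‖) := by
  have hC0 : 0 ≤ C := (norm_nonneg _).trans (hC 0)
  set Q := qFun f r γ L
  set A := inner ℝ p.1 (f z) + L * ‖p.2‖
  set c₁ := Kr * (C + L) + γ * Cr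
  set c₂ := ‖p.1‖ * K * (C + L)
  have key : ∀ ε : ℝ, 0 < ε → ∀ᶠ h in 𝓝[>] (0 : ℝ),
      h⁻¹ * (1 - Real.exp (-γ * h)) * Q z ≤
        ε + (r z + c₁ * h) + Real.exp (-γ * h) * (A + c₂ * h + ε * (C + L)) := by
    intro ε hε
    obtain ⟨δ, hδ, hball⟩ := Metric.eventually_nhds_iff.1 (hp ε hε)
    have hsmall : ∀ᶠ h in 𝓝[>] (0 : ℝ), (C + L) * h < δ := by
      have : Tendsto (fun h : ℝ => (C + L) * h) (𝓝 0) (𝓝 ((C + L) * 0)) :=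
        (continuous_const_mul (C + L)).tendsto 0
      rw [mul_zero] at this
      exact (this.mono_left nhdsWithin_le_nhds).eventually_lt_const hδ
    filter_upwards [hsmall, self_mem_nhdsWithin] with h hh hpos
    rw [mem_Ioi] at hpos
    -- A pair within `ε h` of the supremum, so the loss is `ε` after division by `h`. The pair
    -- varies with `h`, hence the need for estimates uniform over pairs.
    obtain ⟨_, ⟨w, hw, rfl⟩, hlt⟩ := exists_lt_of_lt_csSup (hne.image (reward r γ 0))
      (show Q z - ε * h < Q z by linarith [mul_pos hε hpos])
    have hz : (w.1 0, w.2 0) = z := Prod.ext hw.1.2.1 hw.2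
    have hsplit := reward_split hγ hKr.continuous hCr hw.1 hpos.le
    have hint := integral_rewardIntegrand_le hγ hC hCr hKr hL hw.1 hpos.le
    have hQ := reward_le_qFun hγ hCr hw.1 hpos.le
    have hdot := dot_pair_sub_le hC hK hL hw.1 hpos.le p
    have hdist := norm_pair_sub_le hC hL hw.1 hpos.le
    rw [hz, sub_zero] at hdist
    rw [hz] at hdot hint
    have hsup := hball (y := (w.1 h, w.2 h)) (by
      rw [dist_eq_norm]
      exact hdist.trans_lt hh)
    have he := Real.exp_pos (-γ * h)
    have hQ' : reward r γ h w ≤ Q z + h * (A + c₂ * h + ε * (C + L)) := by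
      have := mul_le_mul_of_nonneg_left hdist hε.le
      linarith
    have hfin := mul_le_mul_of_nonneg_left hQ' he.le
    rw [sub_zero] at hsplit
    rw [mul_assoc, inv_mul_le_iff₀ hpos]
    linarith
  have hexp : Tendsto (fun h : ℝ => Real.exp (-γ * h)) (𝓝[>] 0) (𝓝 1) := by
    have : Continuous fun h : ℝ => Real.exp (-γ * h) := by fun_prop
    simpa using (this.tendsto 0).mono_left nhdsWithin_le_nhds
  have hid : Tendsto (fun h : ℝ => h) (𝓝[>] 0) (𝓝 0) := tendsto_id.mono_left nhdsWithin_le_nhds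
  have hquot : Tendsto (fun h : ℝ => h⁻¹ * (1 - Real.exp (-γ * h))) (𝓝[>] 0) (𝓝 γ) := by
    have hd : HasDerivAt (fun h : ℝ => 1 - Real.exp (-γ * h)) γ 0 := by
      simpa using (((hasDerivAt_id (0 : ℝ)).const_mul (-γ)).exp).const_sub 1
    have := hasDerivAt_iff_tendsto_slope_zero.1 hd
    simp only [zero_add, mul_zero, Real.exp_zero, sub_self, sub_zero, smul_eq_mul] at this
    exact this.mono_left (nhdsWithin_mono _ fun h hh => ne_of_gt hh)
  have hlim : ∀ ε : ℝ, 0 < ε → γ * Q z ≤ r z + A + ε * (1 + (C + L)) := by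
    intro ε hε
    have h1 := le_of_tendsto_of_tendsto (hquot.mul_const (Q z))
      ((((hid.const_mul c₁).const_add (r z)).const_add ε).add
        (hexp.mul (((hid.const_mul c₂).const_add A).add_const (ε * (C + L))))) (key ε hε)
    linarith
  suffices h : γ * Q z ≤ r z + A from h
  refine le_of_forall_pos_le_add fun η hη => ?_
  have h := hlim (η / (1 + (C + L))) (by positivity)
  rwa [div_mul_cancel₀ _ (by positivity)] at h

/-! ### Chain rule for supergradients -/

/-- The one-sided bound suffices because `τ - s` changes sign: right quotients are at most `ε`, left
quotients at least `-ε`. -/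
lemma eq_zero_of_hasDerivAt_of_eventually_le {g : ℝ → ℝ} {c s : ℝ} (hg : HasDerivAt g c s)
    (h : ∀ ε : ℝ, 0 < ε → ∀ᶠ τ in 𝓝 s, g τ - g s ≤ ε * |τ - s|) : c = 0 := by
  have hs := hasDerivAt_iff_tendsto_slope.1 hg
  refine le_antisymm (le_of_forall_pos_le_add fun ε hε => ?_)
    (le_of_forall_pos_le_add fun ε hε => ?_)
  · rw [zero_add]
    refine le_of_tendsto (hs.mono_left (nhdsGT_le_nhdsNE s)) ?_
    filter_upwards [mem_nhdsWithin_of_mem_nhds (h ε hε), self_mem_nhdsWithin] with τ h1 h2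
    have h3 : 0 < τ - s := sub_pos.2 h2
    rw [abs_of_pos h3] at h1
    rwa [slope_def_field, div_le_iff₀ h3]
  · rw [← neg_le_iff_add_nonneg]
    refine ge_of_tendsto (hs.mono_left (nhdsLT_le_nhdsNE s)) ?_
    filter_upwards [mem_nhdsWithin_of_mem_nhds (h ε hε), self_mem_nhdsWithin] with τ h1 h2
    have h3 : τ - s < 0 := sub_neg.2 h2
    rw [abs_of_neg h3] at h1
    rw [slope_def_field, le_div_iff_of_neg h3]
    linarith

/-- Chain rule along a curve with any element of the superdifferential. -/
lemma hasDerivAt_comp_eq_of_mem_superDiff {u : E n × E m → ℝ} {x : ℝ → E n} {a : ℝ → E m}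
    {x' : E n} {a' : E m} {s D : ℝ} {p : E n × E m} (hx : HasDerivAt x x' s)
    (ha : HasDerivAt a a' s) (hu : HasDerivAt (fun τ => u (x τ, a τ)) D s)
    (hp : p ∈ superDiff u (x s, a s)) : D = inner ℝ p.1 x' + inner ℝ p.2 a' := by
  have hx' : HasDerivAt (fun τ => inner ℝ p.1 (x τ)) (inner ℝ p.1 x') s :=
    (innerSL ℝ p.1).hasFDerivAt.comp_hasDerivAt s hx
  have ha' : HasDerivAt (fun τ => inner ℝ p.2 (a τ)) (inner ℝ p.2 a') s :=
    (innerSL ℝ p.2).hasFDerivAt.comp_hasDerivAt s ha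
  rw [← sub_eq_zero]
  refine eq_zero_of_hasDerivAt_of_eventually_le (hu.sub (hx'.add ha')) fun ε hε => ?_
  obtain ⟨c, hc, hO⟩ := (hx.prodMk ha).isBigO_sub.exists_pos
  have hcont : Tendsto (fun τ => (x τ, a τ)) (𝓝 s) (𝓝 (x s, a s)) := (hx.prodMk ha).continuousAt
  -- The curve's increment is at most `c |τ - s|`, so tolerance `ε / c` in space becomes `ε` in
  -- time.
  filter_upwards [hO.bound, hcont.eventually (hp (ε / c) (div_pos hε hc))] with τ h1 h2
  have h3 := mul_le_mul_of_nonneg_left h1 (div_pos hε hc).le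
  rw [← mul_assoc, div_mul_cancel₀ _ hc.ne', Real.norm_eq_abs] at h3
  simp only [dot, Prod.mk_sub_mk, inner_sub_right] at h2
  refine le_trans (le_of_eq ?_) (h2.trans h3)
  simp only [Pi.sub_apply, Pi.add_apply]
  ring

/-! ### Verification along the trajectory -/

lemma lipschitzOnWith_pair {C : ℝ} (hC : ∀ z, ‖f z‖ ≤ C) (hw : w ∈ AdmissiblePairs f L t x₀) :
    ∃ K, LipschitzOnWith K (fun s => (w.1 s, w.2 s)) (Ici t) := by
  obtain ⟨⟨⟨K, hK⟩, -⟩, -, hx⟩ := hw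
  have hx' : LipschitzOnWith C.toNNReal w.1 (Ici t) :=
    (convex_Ici t).lipschitzOnWith_of_nnnorm_hasDerivWithin_le hx fun s _ =>
      NNReal.coe_le_coe.1 ((hC _).trans (Real.le_coe_toNNReal C))
  exact ⟨_, hx'.prodMk hK⟩

lemma absolutelyContinuousOnInterval_comp_pair {C : ℝ} (hC : ∀ z, ‖f z‖ ≤ C)
    (hw : w ∈ AdmissiblePairs f L t x₀) {u : E n × E m → ℝ}
    (hu : ∀ s ∈ Ici t, ∃ K : ℝ≥0, ∃ U ∈ 𝓝 (w.1 s, w.2 s), LipschitzOnWith K u U)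
    {T : ℝ} (hT : t ≤ T) :
    AbsolutelyContinuousOnInterval (fun s => u (w.1 s, w.2 s)) t T := by
  obtain ⟨M, hM⟩ := lipschitzOnWith_pair hC hw
  have hloc : LocallyLipschitzOn (uIcc t T) (fun s => u (w.1 s, w.2 s)) := fun s hs => by
    rw [uIcc_of_le hT] at hs ⊢
    obtain ⟨K, U, hU, hK⟩ := hu s hs.1
    have hcont := ((hM.continuousOn s hs.1).mono (Icc_subset_Ici_self : Icc t T ⊆ Ici t)).tendsto
    refine ⟨K * M, _, inter_mem (hcont hU) self_mem_nhdsWithin, ?_⟩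
    exact hK.comp (hM.mono fun τ hτ => hτ.2.1) fun τ hτ => hτ.1
  obtain ⟨K, hK⟩ := hloc.exists_lipschitzOnWith_of_compact isCompact_uIcc
  exact hK.absolutelyContinuousOnInterval

/-- Verification: if `u` decreases along the trajectory no faster than the discounted reward
accumulates, then the initial value of `u` is at most the reward. -/
lemma le_reward_of_deriv_ge (hγ : 0 < γ) {C Cr B : ℝ} (hC : ∀ z, ‖f z‖ ≤ C)
    (hr : Continuous r) (hCr : ∀ z, |r z| ≤ Cr) (hw : w ∈ AdmissiblePairs f L t x₀)
    {u : E n × E m → ℝ}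
    (hu : ∀ s ∈ Ici t, ∃ K : ℝ≥0, ∃ U ∈ 𝓝 (w.1 s, w.2 s), LipschitzOnWith K u U)
    (hB : ∀ s ∈ Ici t, |u (w.1 s, w.2 s)| ≤ B)
    (hderiv : ∀ᵐ s ∂(volume.restrict (Ici t)), ∀ D,
      HasDerivAt (fun τ => u (w.1 τ, w.2 τ)) D s → γ * u (w.1 s, w.2 s) - r (w.1 s, w.2 s) ≤ D) :
    u (w.1 t, w.2 t) ≤ reward r γ t w := by
  set v : ℝ → ℝ := fun s => u (w.1 s, w.2 s) with hv
  set e : ℝ → ℝ := fun s => Real.exp (-γ * (s - t)) with he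
  have hed : ∀ s, HasDerivAt e (-γ * e s) s := fun s => by
    have := (((hasDerivAt_id s).sub_const t).const_mul (-γ)).exp
    simpa [e, mul_comm] using this
  -- Integrates `(e v)' = e (v' - γ v) ≥ -e r`.
  have hfinite : ∀ T, t ≤ T → v t - e T * v T ≤ ∫ τ in t..T, e τ * r (w.1 τ, w.2 τ) := by
    intro T hT
    have hvac := absolutelyContinuousOnInterval_comp_pair hC hw hu hT
    have heac : AbsolutelyContinuousOnInterval e t T := by
      have hcd : ContDiff ℝ 1 e := by fun_prop
      obtain ⟨K, hK⟩ := hcd.locallyLipschitz.locallyLipschitzOn.exists_lipschitzOnWith_of_compact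
        (isCompact_uIcc (a := t) (b := T))
      exact hK.absolutelyContinuousOnInterval
    have hac := heac.fun_mul hvac
    have hg : IntervalIntegrable (fun τ => e τ * r (w.1 τ, w.2 τ)) volume t T := by
      refine ContinuousOn.intervalIntegrable ?_
      rw [uIcc_of_le hT]
      exact (continuousOn_rewardIntegrand hr hw t).mono Icc_subset_Ici_self
    have hvd : ∀ᵐ s ∂(volume.restrict (Icc t T)), DifferentiableAt ℝ v s := by
      rw [ae_restrict_iff' measurableSet_Icc, ← uIcc_of_le hT]
      exact hvac.ae_differentiableAt
    have hle : ∫ τ in t..T, -(e τ * r (w.1 τ, w.2 τ)) ≤ ∫ τ in t..T, deriv (fun s => e s * v s) τ := by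
      refine intervalIntegral.integral_mono_ae_restrict hT hg.neg hac.intervalIntegrable_deriv ?_
      filter_upwards [hvd, ae_restrict_of_ae_restrict_of_subset Icc_subset_Ici_self hderiv]
        with s h1 h2
      have h3 := mul_le_mul_of_nonneg_left (h2 _ h1.hasDerivAt) (Real.exp_pos (-γ * (s - t))).le
      rw [((hed s).fun_mul h1.hasDerivAt).deriv]
      simp only [he, hv] at h3 ⊢
      linarith
    rw [hac.integral_deriv_eq_sub, intervalIntegral.integral_neg] at hle
    have : e t = 1 := by simp [e]
    rw [this, one_mul] at hle
    linarith
  have he0 : Tendsto e atTop (𝓝 0) := by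
    refine Real.tendsto_exp_atBot.comp ?_
    exact (tendsto_atTop_add_const_right _ (-t) tendsto_id).const_mul_atTop_of_neg
      (neg_neg_of_pos hγ)
  have hev : Tendsto (fun T => e T * v T) atTop (𝓝 0) := by
    refine squeeze_zero_norm' ?_ (by simpa using he0.mul_const B)
    filter_upwards [eventually_ge_atTop t] with T hT
    rw [norm_mul, Real.norm_of_nonneg (Real.exp_pos _).le]
    exact mul_le_mul_of_nonneg_left (hB T hT) (Real.exp_pos _).le
  have hint := intervalIntegral_tendsto_integral_Ioi t
    (integrableOn_rewardIntegrand hγ hr hCr hw t) tendsto_id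
  have := le_of_tendsto_of_tendsto (hev.const_sub (v t)) hint
    ((eventually_ge_atTop t).mono hfinite)
  rwa [sub_zero] at this

/-- A control steered by the superdifferential of the Q-function attains the Q-function. -/
theorem qFun_le_reward (hγ : 0 < γ) (hL : 0 ≤ L) {C Cr : ℝ} {K Kr : ℝ≥0}
    (hC : ∀ z, ‖f z‖ ≤ C) (hCr : ∀ z, |r z| ≤ Cr) (hK : LipschitzWith K f)
    (hKr : LipschitzWith Kr r) (hw : w ∈ AdmissiblePairs f L t x₀)
    (hode : ∀ᵐ s ∂(volume.restrict (Ici t)), ∀ p ∈ superDiff (qFun f r γ L) (w.1 s, w.2 s),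
      p.2 ≠ 0 → HasDerivAt w.2 ((L / ‖p.2‖) • p.2) s)
    (hQlip : ∀ s ∈ Ici t, ∃ K : ℝ≥0, ∃ U ∈ 𝓝 (w.1 s, w.2 s), LipschitzOnWith K (qFun f r γ L) U)
    (hne : ∀ᵐ s ∂(volume.restrict (Ici t)), (superDiff (qFun f r γ L) (w.1 s, w.2 s)).Nonempty) :
    qFun f r γ L (w.1 t, w.2 t) ≤ reward r γ t w := by
  have hpairs : ∀ s ∈ Ici t, (AdmissiblePairsFrom f L 0 (w.1 s) (w.2 s)).Nonempty := fun s hs =>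
    ⟨_, shift_mem hs hw⟩
  refine le_reward_of_deriv_ge hγ hC hKr.continuous hCr hw hQlip
    (fun s hs => abs_qFun_le hγ hCr _ (hpairs s hs)) ?_
  filter_upwards [hode, hne, hw.1.ae_differentiableAt, ae_restrict_Ici_lt t]
    with s h1 ⟨p, hp⟩ h3 hts D hD
  have hx := (hw.2.2 s hts.le).hasDerivAt (Ici_mem_nhds hts)
  rw [hasDerivAt_comp_eq_of_mem_superDiff hx h3.hasDerivAt hD hp]
  -- The steering direction turns Cauchy–Schwarz into equality.
  have hpa : inner ℝ p.2 (deriv w.2 s) = L * ‖p.2‖ := by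
    by_cases h0 : p.2 = 0
    · simp [h0]
    · rw [(h1 p hp h0).deriv, real_inner_smul_right, real_inner_self_eq_norm_mul_norm]
      have := norm_ne_zero_iff.2 h0
      field_simp
  have := qFun_le_hamiltonian_of_mem_superDiff hγ hL hC hCr hK hKr (hpairs s hts.le) hp
  linarith

end LipControl

theorem theorem1 {n m : ℕ}
    (f : LipControl.E n × LipControl.E m → LipControl.E n)
    (r : LipControl.E n × LipControl.E m → ℝ)
    (γ L : ℝ) (hγ : 0 < γ) (hL : 0 ≤ L)
    -- `f` and `r` are bounded and Lipschitz
    (hfb : ∃ C : ℝ, ∀ z, ‖f z‖ ≤ C) (hrb : ∃ C : ℝ, ∀ z, |r z| ≤ C)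
    (hfl : ∃ K : ℝ≥0, LipschitzWith K f) (hrl : ∃ K : ℝ≥0, LipschitzWith K r)
    (t : ℝ) (x₀ : LipControl.E n) (a₀ : LipControl.E m)
    -- the control `as` starts at `a₀`, and `xs` is its state trajectory started at `x₀`
    (xs : ℝ → LipControl.E n) (as : ℝ → LipControl.E m)
    (hs : (xs, as) ∈ LipControl.AdmissiblePairsFrom f L t x₀ a₀)
    -- the differential equation for the control; no constraint where `p₂ = 0`
    (hode : ∀ᵐ s ∂(volume.restrict (Ici t)),
      ∀ p ∈ LipControl.superDiff (LipControl.qFun f r γ L) (xs s, as s) ∪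
          LipControl.subDiff (LipControl.qFun f r γ L) (xs s, as s),
        p.2 ≠ 0 → HasDerivAt as ((L / ‖p.2‖) • p.2) s)
    -- `Q` is locally Lipschitz around the trajectory
    (hQlip : ∀ s ∈ Ici t, ∃ K : ℝ≥0, ∃ U ∈ 𝓝 (xs s, as s),
      LipschitzOnWith K (LipControl.qFun f r γ L) U)
    (hclarke : ∀ᵐ s ∂(volume.restrict (Ici t)),
      LipControl.superDiff (LipControl.qFun f r γ L) (xs s, as s) =
        LipControl.clarkeGradient (LipControl.qFun f r γ L) (xs s, as s)) :
    IsMaxOn (LipControl.reward r γ t) (LipControl.AdmissiblePairsFrom f L t x₀ a₀) (xs, as) ∧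
    ((∀ a' : LipControl.E m,
        LipControl.qFun f r γ L (x₀, a') ≤ LipControl.qFun f r γ L (x₀, a₀)) →
      IsMaxOn (LipControl.reward r γ t) (LipControl.AdmissiblePairs f L t x₀) (xs, as)) := by
  obtain ⟨C, hC⟩ := hfb
  obtain ⟨Cr, hCr⟩ := hrb
  obtain ⟨K, hK⟩ := hfl
  obtain ⟨Kr, hKr⟩ := hrl
  obtain ⟨hw, has⟩ := hs
  have hz : (xs t, as t) = (x₀, a₀) := Prod.ext hw.2.1 has
  have hne : ∀ᵐ s ∂(volume.restrict (Ici t)),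
      (LipControl.superDiff (LipControl.qFun f r γ L) (xs s, as s)).Nonempty := by
    filter_upwards [hclarke, ae_restrict_mem measurableSet_Ici] with s h1 h2
    obtain ⟨M, U, hU, hM⟩ := hQlip s h2
    rw [h1]
    exact LipControl.clarkeGradient_nonempty hU hM
  have hle := LipControl.qFun_le_reward hγ hL hC hCr hK hKr hw
    (hode.mono fun s h p hp => h p (Or.inl hp)) hQlip hne
  simp only [hz] at hle
  -- Each competitor is compared with Q at its own initial control, so maximality of `a₀` settles
  -- the second claim.
  have hmax : ∀ w ∈ LipControl.AdmissiblePairs f L t x₀,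
      LipControl.reward r γ t w ≤ LipControl.qFun f r γ L (x₀, w.2 t) := fun w hw => by
    have := LipControl.reward_le_qFun hγ hCr hw le_rfl
    rwa [hw.2.1] at this
  refine ⟨fun w hw' => ?_, fun hopt w hw' => (hmax w hw').trans ((hopt _).trans hle)⟩
  have := hmax w hw'.1
  rw [hw'.2] at this
  exact this.trans hle
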